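/- Regard $\{0,1\}^d$ as the vertex set of the hypercube graph, in which two points are adjacent iff they differ in exactly one coordinate, and let $\mathrm{dist}$ be its shortest-path distance. A function $g:\{0,1\}^d\to\mathbb{R}$ is Lipschitz if $|g(x)-g(y)|\le \mathrm{dist}(x,y)$ for all $x,y$. For a probability distribution $D$ on $\{0,1\}^d$, let $\ell_{0,D}(f,\mathcal{L}ip)=\min_{g\text{ Lipschitz}}\Pr_{x\sim D}[f(x)\neq g(x)]$. For $r>0$, a distribution-free Lipschitz $\frac12$-tester for functions $\{0,1\}^d\to[0,r]$ is a randomized, possibly adaptive algorithm $\mathcal{T}$ that, on an input consisting of a function $f:\{0,1\}^d\to[0,r]$ and a distribution $D$ on $\{0,1\}^d$, may query $f$ at points of its choice and draw independent samples from $D$, such that for every such $(f,D)$: if $f$ is Lipschitz, then $\mathcal{T}(f,D)$ accepts with probability at least $2/3$, and if $\ell_{0,D}(f,\mathcal{L}ip)\ge\frac12$, then $\mathcal{T}(f,D)$ rejects with probability at least $2/3$. The sample (respectively, query) complexity of $\mathcal{T}(f,D)$ is the maximum number in $\mathbb{N}\cup\{\infty\}$ of samples drawn (respectively, queries made) over all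 executions of $\mathcal{T}$ on $(f,D)$, up to an event of probability zero. Theorem. There exist absolute constants $c>0$ and $d_0\in\mathbb{N}$ such that for all integers $d\ge d_0$, all even integers $r$ with $4\le r\le 2^{-16}d$, and every distribution-free Lipschitz $\frac12$-tester $\mathcal{T}$ for functions $\{0,1\}^d\to[0,r]$, there exist a function $f:\{0,1\}^d\to[0,r]$ and a distribution $D$ on $\{0,1\}^d$ such that $\mathcal{T}(f,D)$ has sample complexity at least $2^{cd}$ or query complexity at least $(d/r)^{cr}$. -/

import Mathlib

open scoped ENNReal
open MeasureTheory

universe u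

namespace LipschitzTesting

/-- The vertex set `{0,1}^d`. -/
abbrev Cube (d : ℕ) : Type := Fin d → Bool

/-- The `d`-dimensional hypercube graph: two vertices are adjacent iff they differ in exactly one
coordinate. -/
def hypercube (d : ℕ) : SimpleGraph (Cube d) where
  Adj x y := hammingDist x y = 1
  symm := ⟨fun x y h => by rw [hammingDist_comm]; exact h⟩
  loopless := ⟨fun x h => by simp at h⟩

/-- `f` is Lipschitz with respect to the graph metric of the hypercube. -/
def IsLip {d : ℕ} (f : Cube d → ℝ) : Prop :=
  ∀ x y : Cube d, |f x - f y| ≤ ((hypercube d).dist x y : ℝ)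

/-- The `ℓ₀`-distance of `f` to the set of Lipschitz functions with respect to a distribution `D`:
the minimum over Lipschitz `g` of `Pr_{x ∼ D}[f x ≠ g x]`. -/
noncomputable def distToLip {d : ℕ} (D : PMF (Cube d)) (f : Cube d → ℝ) : ℝ≥0∞ :=
  ⨅ g : {g : Cube d → ℝ // IsLip g}, D.toMeasure {x | f x ≠ g.1 x}

/-- What an algorithm may do next: query the input function at a point, draw a fresh sample from
the input distribution, or halt with a verdict. -/
inductive Action (d : ℕ) : Type
  | query (x : Cube d)
  | sample
  | accept
  | reject

/-- What an algorithm gets back: the value at a queried point, or a sampled point. -/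
inductive Answer (d : ℕ) : Type
  | value (v : ℝ)
  | point (x : Cube d)

/-- Whether an answer is a sampled point. -/
def Answer.isPoint {d : ℕ} : Answer d → Bool
  | .value _ => false
  | .point _ => true

/-- The number of samples drawn in a transcript. -/
def numSamples {d : ℕ} (t : List (Answer d)) : ℕ := t.countP fun a => a.isPoint

/-- The number of queries made in a transcript. -/
def numQueries {d : ℕ} (t : List (Answer d)) : ℕ := t.countP fun a => !a.isPoint

/-- A randomized, adaptive algorithm with query access to a function on `{0,1}^d` and sample access
to a distribution on `{0,1}^d`. Its internal randomness is a seed from an arbitrary probability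
space; its next action is a function of the seed and of all answers received so far (which
determine its own earlier actions). There is no a priori bound on the length of a run. -/
structure Algorithm (d : ℕ) where
  /-- The set of random seeds. -/
  Seed : Type u
  /-- The events on seeds. -/
  [measurableSpace : MeasurableSpace Seed]
  /-- The distribution of the seed. -/
  seedLaw : Measure Seed
  /-- The seed is drawn from a probability distribution. -/
  [isProbabilityMeasure : IsProbabilityMeasure seedLaw]
  /-- The next action, given the seed and the answers so far. -/
  next : Seed → List (Answer d) → Action d
  /-- For every sequence of answers, the next action is a random variable. -/
  measurableSet_next : ∀ (t : List (Answer d)) (a : Action d), MeasurableSet {ρ | next ρ t = a}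

attribute [instance] Algorithm.measurableSpace Algorithm.isProbabilityMeasure

namespace Algorithm

variable {d : ℕ} (T : Algorithm.{u} d)

/-- The answers received during the first `n` steps of the run of `T` on the function `f`, when the
seed is `ρ` and the successive samples are `s 0, s 1, s 2, …`. Nothing changes after halting. -/
def transcript (f : Cube d → ℝ) (ρ : T.Seed) (s : ℕ → Cube d) : ℕ → List (Answer d)
  | 0 => []
  | n + 1 =>
    match T.next ρ (transcript f ρ s n) with
    | .query x => transcript f ρ s n ++ [.value (f x)]
    | .sample => transcript f ρ s n ++ [.point (s (numSamples (transcript f ρ s n)))]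
    | .accept => transcript f ρ s n
    | .reject => transcript f ρ s n

/-- The law of the seed together with an independent sequence of i.i.d. samples from `D`. -/
noncomputable def runLaw (D : PMF (Cube d)) : Measure (T.Seed × (ℕ → Cube d)) :=
  T.seedLaw.prod (Measure.infinitePi fun _ : ℕ => D.toMeasure)

/-- The probability that `T` halts and accepts on input `(f, D)`. -/
noncomputable def acceptProb (f : Cube d → ℝ) (D : PMF (Cube d)) : ℝ≥0∞ :=
  T.runLaw D {p | ∃ n, T.next p.1 (T.transcript f p.1 p.2 n) = .accept}

/-- The probability that `T` halts and rejects on input `(f, D)`. -/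
noncomputable def rejectProb (f : Cube d → ℝ) (D : PMF (Cube d)) : ℝ≥0∞ :=
  T.runLaw D {p | ∃ n, T.next p.1 (T.transcript f p.1 p.2 n) = .reject}

/-- The sample complexity of `T` on input `(f, D)`: the worst case, over all executions up to an
event of probability zero, of the total number of samples drawn (possibly infinite). -/
noncomputable def sampleComplexity (f : Cube d → ℝ) (D : PMF (Cube d)) : ℕ∞ :=
  essSup (fun p => ⨆ n, (numSamples (T.transcript f p.1 p.2 n) : ℕ∞)) (T.runLaw D)

/-- The query complexity of `T` on input `(f, D)`: the worst case, over all executions up to an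
event of probability zero, of the total number of queries made (possibly infinite). -/
noncomputable def queryComplexity (f : Cube d → ℝ) (D : PMF (Cube d)) : ℕ∞ :=
  essSup (fun p => ⨆ n, (numQueries (T.transcript f p.1 p.2 n) : ℕ∞)) (T.runLaw D)

/-- `T` is a distribution-free Lipschitz `ε`-tester for functions `{0,1}^d → [0,r]`. -/
def IsDistributionFreeLipTester (r : ℝ) (ε : ℝ≥0∞) : Prop :=
  ∀ (f : Cube d → ℝ) (D : PMF (Cube d)), (∀ x, f x ∈ Set.Icc 0 r) →
    (IsLip f → 2 / 3 ≤ T.acceptProb f D) ∧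
    (ε ≤ distToLip D f → 2 / 3 ≤ T.rejectProb f D)

end Algorithm

end LipschitzTesting

namespace LipschitzTesting

/-! ### The hypercube metric -/

/-! Put r = 2h. A Gilbert–Varshamov code on half of the coordinates (`exists_code`) yields
exponentially many cells, copies of a cube of dimension about d/2 at mutual distance at least 2h
(`exists_cells`). In each cell c plant a low apex `u c` (value 0) and a high apex (value 2h)
differing from it in a set Y common to all cells. The function is h away from the cones of radius h
around the apexes, and D is uniform on apexes. If |Y| = 2h the function is Lipschitz; if |Y| = 2h -
1, every Lipschitz function errs on an apex of every cell, so the distance is at least 1/2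
(`half_le_distToLip`).

With few samples no cell is hit twice (`indexLaw_collision_le`, `samples_sq_le`), so at most one
apex per cell is seen. For fixed Y, the positions v of these visible apexes are uniform when u is,
so they carry no information on Y. The run can then be compared with one on `visibleFn`, which shows
only the cones at v. The two differ only if a query comes within distance less than h of a hidden
apex; each query does so for at most a Hamming ball's worth of Y, few among all sets of the given
size (`card_near_hidden_le`, `queries_mul_ballCard_le`).

Hence a tester obeying both bounds would make the same visible runs accept and reject with
probability at least 2/3 - 1/12 each (`le_lintegral_visibleRuns`), which sums to more than 1. -/

theorem hypercube_exists_walk {d : ℕ} : ∀ (n : ℕ) (x y : Cube d), hammingDist x y = n →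
    ∃ w : (hypercube d).Walk x y, w.length = n := by
  intro n
  induction n with
  | zero =>
    intro x y h
    obtain rfl := hammingDist_eq_zero.1 h
    exact ⟨.nil, rfl⟩
  | succ n ih =>
    intro x y h
    have hne : (Finset.univ.filter fun i => x i ≠ y i).Nonempty := by
      rw [← Finset.card_pos]
      change 0 < hammingDist x y
      omega
    obtain ⟨i, hi⟩ := hne
    have hi' : x i ≠ y i := by simpa using hi
    have h1 : hammingDist x (Function.update x i (y i)) = 1 := by
      unfold hammingDist
      rw [Finset.card_eq_one]
      refine ⟨i, ?_⟩
      ext j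
      by_cases hj : j = i
      · subst hj; simpa using hi'
      · simp [hj]
    have h2 : hammingDist (Function.update x i (y i)) y = n := by
      unfold hammingDist at h ⊢
      have : (Finset.univ.filter fun j => Function.update x i (y i) j ≠ y j)
          = (Finset.univ.filter fun j => x j ≠ y j).erase i := by
        ext j
        by_cases hj : j = i
        · subst hj; simp
        · simp [hj]
      rw [this, Finset.card_erase_of_mem hi, h]
      rfl
    obtain ⟨w, hw⟩ := ih _ _ h2
    exact ⟨.cons (show (hypercube d).Adj _ _ from h1) w, by simp [hw]⟩

theorem hammingDist_le_walk_length {d : ℕ} {x y : Cube d} (w : (hypercube d).Walk x y) :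
    hammingDist x y ≤ w.length := by
  induction w with
  | nil => simp
  | @cons a b c h p ih =>
    have h' : hammingDist a b = 1 := h
    have := hammingDist_triangle a b c
    rw [SimpleGraph.Walk.length_cons]
    omega

theorem hypercube_dist {d : ℕ} (x y : Cube d) : (hypercube d).dist x y = hammingDist x y := by
  obtain ⟨w, hw⟩ := hypercube_exists_walk _ x y rfl
  refine le_antisymm (hw ▸ SimpleGraph.dist_le w) ?_
  have hr : (hypercube d).Reachable x y := ⟨w⟩
  obtain ⟨w', hw'⟩ := hr.exists_walk_length_eq_dist
  exact hw' ▸ hammingDist_le_walk_length w'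

/-! ### Flipping coordinates and counting balls -/

/-- The point obtained from `x` by flipping the coordinates in `Y`. -/
def flip {n : ℕ} (x : Cube n) (Y : Finset (Fin n)) : Cube n := fun i => xor (x i) (decide (i ∈ Y))

theorem flip_flip {n : ℕ} (x : Cube n) (Y : Finset (Fin n)) : flip (flip x Y) Y = x := by
  funext i; simp [flip]

theorem hammingDist_flip {n : ℕ} (x : Cube n) (Y : Finset (Fin n)) :
    hammingDist x (flip x Y) = Y.card := by
  unfold hammingDist
  congr 1
  ext i
  rw [Finset.mem_filter]
  by_cases h : i ∈ Y <;> simp [flip, h]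

/-- The number of sets of at most `m` elements of `Fin n`, that is, the volume of a ball of
radius `m` in the cube. -/
def ballCard (n m : ℕ) : ℕ := ((Finset.univ : Finset (Finset (Fin n))).filter (·.card ≤ m)).card

theorem card_le_ballCard {n m : ℕ} {α : Type*} (s : Finset α) (F : α → Cube n) (x : Cube n)
    (hF : Set.InjOn F s) (hm : ∀ a ∈ s, hammingDist x (F a) ≤ m) : s.card ≤ ballCard n m := by
  refine Finset.card_le_card_of_injOn (fun a => Finset.univ.filter fun i => x i ≠ F a i) ?_ ?_
  · intro a ha
    exact Finset.mem_filter.2 ⟨Finset.mem_univ _, hm a ha⟩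
  · intro a ha b hb hab
    refine hF ha hb (funext fun i => ?_)
    have := congrArg (i ∈ ·) hab
    simp only [Finset.mem_filter, Finset.mem_univ, true_and, eq_iff_iff] at this
    revert this
    cases x i <;> cases F a i <;> cases F b i <;> simp

theorem card_flip_near_le {n m : ℕ} (s : Finset (Finset (Fin n))) (x v : Cube n) :
    (s.filter fun Y => hammingDist x (flip v Y) ≤ m).card ≤ ballCard n m := by
  refine card_le_ballCard _ (flip v) x ?_ fun Y hY => (Finset.mem_filter.1 hY).2
  intro Y _ Z _ h
  ext i
  have := congrFun h i
  simp only [flip] at this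
  by_cases h1 : i ∈ Y <;> by_cases h2 : i ∈ Z <;> simp_all

/-- Expand (1 + x)^n as the sum of x^|t| over all sets t; since x ≤ 1, each set of size at most m
contributes at least x^m. -/
theorem ballCard_mul_pow_le (n m : ℕ) {x : ℝ} (hx : 0 < x) (hx1 : x ≤ 1) :
    (ballCard n m : ℝ) * x ^ m ≤ (1 + x) ^ n := by
  have h := Finset.sum_pow_mul_eq_add_pow x 1 (Finset.univ : Finset (Fin n))
  simp only [one_pow, mul_one, Finset.card_univ, Fintype.card_fin, Finset.powerset_univ] at h
  rw [add_comm 1 x, ← h, ballCard, ← nsmul_eq_mul]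
  refine (Finset.card_nsmul_le_sum _ (fun t => x ^ t.card) _ fun t ht => ?_).trans
    (Finset.sum_le_univ_sum_of_nonneg fun t => by positivity)
  exact pow_le_pow_of_le_one hx.le hx1 (Finset.mem_filter.1 ht).2

/-- The Gilbert–Varshamov bound: a maximal code of minimum distance `r`. -/
theorem exists_code (n r : ℕ) : ∃ C : Finset (Cube n),
    (∀ x ∈ C, ∀ y ∈ C, x ≠ y → r ≤ hammingDist x y) ∧ 2 ^ n ≤ C.card * ballCard n (r - 1) := by
  classical
  let P : Finset (Finset (Cube n)) :=
    Finset.univ.filter fun C => ∀ x ∈ C, ∀ y ∈ C, x ≠ y → r ≤ hammingDist x y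
  obtain ⟨C, hC, hmax⟩ := P.exists_max_image Finset.card ⟨∅, by simp [P]⟩
  have hC' : ∀ x ∈ C, ∀ y ∈ C, x ≠ y → r ≤ hammingDist x y := (Finset.mem_filter.1 hC).2
  refine ⟨C, hC', ?_⟩
  -- An uncovered point could be added to the code, against maximality.
  have hcover : ∀ z : Cube n, ∃ x ∈ C, hammingDist x z ≤ r - 1 := by
    intro z
    by_contra! hz
    have hzC : z ∉ C := fun h => by simpa using hz z h
    have : insert z C ∈ P := by
      refine Finset.mem_filter.2 ⟨Finset.mem_univ _, ?_⟩
      intro x hx y hy hxy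
      rcases Finset.mem_insert.1 hx with rfl | hx' <;> rcases Finset.mem_insert.1 hy with rfl | hy'
      · exact absurd rfl hxy
      · rw [hammingDist_comm]; have := hz y hy'; omega
      · have := hz x hx'; omega
      · exact hC' x hx' y hy' hxy
    have := hmax _ this
    rw [Finset.card_insert_of_notMem hzC] at this
    omega
  have hsub : (Finset.univ : Finset (Cube n)) ⊆
      C.biUnion fun x => Finset.univ.filter fun z => hammingDist x z ≤ r - 1 := by
    intro z _
    simpa using hcover z
  calc 2 ^ n = (Finset.univ : Finset (Cube n)).card := by simp
    _ ≤ _ := Finset.card_le_card hsub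
    _ ≤ _ := Finset.card_biUnion_le_card_mul _ _ _ fun x _ =>
        card_le_ballCard _ id x (Set.injOn_id _) fun a ha => (Finset.mem_filter.1 ha).2

/-! ### Functions with conical dents and bumps -/

/-- The upper envelope of the cones of height `h` with apexes in `S`. -/
def bump {d : ℕ} (h : ℕ) (S : Finset (Cube d)) (z : Cube d) : ℕ := S.sup fun p => h - hammingDist z p

theorem bump_le {d h : ℕ} {S : Finset (Cube d)} {z : Cube d} : bump h S z ≤ h :=
  Finset.sup_le fun _ _ => Nat.sub_le _ _

theorem bump_eq_of_mem {d h : ℕ} {S : Finset (Cube d)} {z : Cube d} (hz : z ∈ S) :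
    bump h S z = h :=
  le_antisymm bump_le ((by simp : h ≤ h - hammingDist z z).trans
    (Finset.le_sup (f := fun p => h - hammingDist z p) hz))

theorem bump_eq_zero {d h : ℕ} {S : Finset (Cube d)} {z : Cube d}
    (hz : ∀ p ∈ S, h ≤ hammingDist z p) : bump h S z = 0 :=
  Nat.le_zero.1 (Finset.sup_le fun p hp => by have := hz p hp; omega)

theorem bump_le_add {d h : ℕ} {S : Finset (Cube d)} (z z' : Cube d) :
    bump h S z ≤ bump h S z' + hammingDist z z' := by
  refine Finset.sup_le fun p hp => ?_
  have h1 := Finset.le_sup (f := fun p => h - hammingDist z' p) hp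
  have h2 := hammingDist_triangle_left z' p z
  have h3 := hammingDist_comm z z'
  have h4 : h - hammingDist z' p ≤ bump h S z' := h1
  omega

theorem exists_of_bump_pos {d h : ℕ} {S : Finset (Cube d)} {z : Cube d} (hz : 0 < bump h S z) :
    ∃ p ∈ S, bump h S z + hammingDist z p = h := by
  have hS : S.Nonempty := by
    by_contra hS
    rw [Finset.not_nonempty_iff_eq_empty] at hS
    subst hS
    simp [bump] at hz
  obtain ⟨p, hp, hp'⟩ := Finset.exists_mem_eq_sup S hS fun p => h - hammingDist z p
  have : bump h S z = h - hammingDist z p := hp'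
  exact ⟨p, hp, by omega⟩

/-- The function with base level `h`, downward cones at `L` and upward cones at `H`. -/
noncomputable def coneFn {d : ℕ} (h : ℕ) (L H : Finset (Cube d)) (z : Cube d) : ℝ :=
  (h : ℝ) - bump h L z + bump h H z

theorem coneFn_mem_Icc {d h : ℕ} (L H : Finset (Cube d)) (z : Cube d) :
    coneFn h L H z ∈ Set.Icc (0 : ℝ) ((2 * h : ℕ) : ℝ) := by
  have h1 : (bump h L z : ℝ) ≤ h := by exact_mod_cast bump_le
  have h2 : (bump h H z : ℝ) ≤ h := by exact_mod_cast bump_le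
  have h3 : (0 : ℝ) ≤ bump h L z := by positivity
  have h4 : (0 : ℝ) ≤ bump h H z := by positivity
  unfold coneFn
  push_cast
  constructor <;> linarith

/-- Each envelope alone is 1-Lipschitz. The two slopes could only add up if z lay in a low cone and
z' in a high one; then the 2h separation of the apexes leaves room between z and z' for both cone
heights. -/
theorem coneFn_sub_le {d h : ℕ} {L H : Finset (Cube d)}
    (hLH : ∀ p ∈ L, ∀ q ∈ H, 2 * h ≤ hammingDist p q) (z z' : Cube d) :
    coneFn h L H z' - coneFn h L H z ≤ hammingDist z z' := by
  have key : bump h L z + bump h H z' ≤ bump h L z' + bump h H z + hammingDist z z' := by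
    have h1 := bump_le_add (h := h) (S := L) z z'
    have h2 := bump_le_add (h := h) (S := H) z' z
    rw [hammingDist_comm z' z] at h2
    rcases Nat.eq_zero_or_pos (bump h L z) with h0 | h0
    · omega
    rcases Nat.eq_zero_or_pos (bump h H z') with h0' | h0'
    · omega
    obtain ⟨p, hp, hpe⟩ := exists_of_bump_pos h0
    obtain ⟨q, hq, hqe⟩ := exists_of_bump_pos h0'
    have := hLH p hp q hq
    have t1 := hammingDist_triangle p z q
    have t2 := hammingDist_triangle z z' q
    rw [hammingDist_comm p z] at t1
    omega
  have key' : (bump h L z : ℝ) + bump h H z' ≤ bump h L z' + bump h H z + hammingDist z z' := by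
    exact_mod_cast key
  unfold coneFn
  linarith

theorem isLip_coneFn {d h : ℕ} {L H : Finset (Cube d)}
    (hLH : ∀ p ∈ L, ∀ q ∈ H, 2 * h ≤ hammingDist p q) : IsLip (coneFn h L H) := by
  intro x y
  rw [hypercube_dist, abs_le]
  have h1 := coneFn_sub_le hLH x y
  have h2 := coneFn_sub_le hLH y x
  rw [hammingDist_comm y x] at h2
  constructor <;> linarith

/-! ### Runs of an algorithm -/

namespace Algorithm

variable {d : ℕ} (T : Algorithm.{u} d)

/-- The transcript after taking the action `a` at the transcript `t`. -/
def extend (f : Cube d → ℝ) (s : ℕ → Cube d) (t : List (Answer d)) : Action d → List (Answer d)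
  | .query x => t ++ [.value (f x)]
  | .sample => t ++ [.point (s (numSamples t))]
  | .accept => t
  | .reject => t

theorem transcript_succ (f : Cube d → ℝ) (ρ : T.Seed) (s : ℕ → Cube d) (n : ℕ) :
    T.transcript f ρ s (n + 1) =
      extend f s (T.transcript f ρ s n) (T.next ρ (T.transcript f ρ s n)) := by
  rw [transcript]
  cases T.next ρ (T.transcript f ρ s n) <;> rfl

instance countable_action : Countable (Action d) := by
  refine Function.Surjective.countable
    (f := fun a : Option (Option (Option (Cube d))) => match a with
      | none => Action.sample
      | some none => .accept
      | some (some none) => .reject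
      | some (some (some x)) => .query x) ?_
  rintro (x | _ | _ | _)
  · exact ⟨some (some (some x)), rfl⟩
  · exact ⟨none, rfl⟩
  · exact ⟨some none, rfl⟩
  · exact ⟨some (some none), rfl⟩

/-- Real answers make the transcripts an uncountable type, but for a fixed f only countably many
occur; measurability of runs is reduced to countable unions over this range. -/
theorem transcript_mem_range (f : Cube d → ℝ) (ρ : T.Seed) (s : ℕ → Cube d) (n : ℕ) :
    T.transcript f ρ s n ∈
      Set.range (List.map (Sum.elim (fun x => Answer.value (f x)) (Answer.point : Cube d → _))) := by
  induction n with
  | zero => exact ⟨[], rfl⟩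
  | succ n ih =>
    obtain ⟨l, hl⟩ := ih
    rw [transcript_succ, ← hl]
    cases T.next ρ _ with
    | query x => exact ⟨l ++ [.inl x], by simp [extend]⟩
    | sample => exact ⟨l ++ [.inr _], by rw [List.map_append]; rfl⟩
    | accept => exact ⟨l, rfl⟩
    | reject => exact ⟨l, rfl⟩

theorem measurableSet_extend (f : Cube d → ℝ) (t t' : List (Answer d)) (a : Action d) :
    MeasurableSet {s : ℕ → Cube d | extend f s t a = t'} := by
  cases a with
  | sample =>
    have : {s : ℕ → Cube d | extend f s t .sample = t'} =
        (fun s : ℕ → Cube d => s (numSamples t)) ⁻¹' {x | t ++ [.point x] = t'} := rfl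
    rw [this]
    exact measurable_pi_apply _ (Set.toFinite _).measurableSet
  | _ => simp only [extend, MeasurableSet.const]

theorem measurableSet_transcript (f : Cube d → ℝ) (n : ℕ) (t : List (Answer d)) :
    MeasurableSet {p : T.Seed × (ℕ → Cube d) | T.transcript f p.1 p.2 n = t} := by
  induction n generalizing t with
  | zero => simp only [transcript, MeasurableSet.const]
  | succ n ih =>
    have : {p : T.Seed × (ℕ → Cube d) | T.transcript f p.1 p.2 (n + 1) = t} =
        ⋃ t' ∈ Set.range
          (List.map (Sum.elim (fun x => Answer.value (f x)) (Answer.point : Cube d → _))),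
          ⋃ a : Action d, {p | T.transcript f p.1 p.2 n = t'} ∩
            (Prod.fst ⁻¹' {ρ | T.next ρ t' = a} ∩ Prod.snd ⁻¹' {s | extend f s t' a = t}) := by
      ext p
      simp only [Set.mem_iUnion, Set.mem_inter_iff, Set.mem_preimage, Set.mem_ofPred_eq,
        exists_prop]
      rw [transcript_succ]
      constructor
      · intro h
        exact ⟨_, T.transcript_mem_range f p.1 p.2 n, _, rfl, rfl, h⟩
      · rintro ⟨t', _, a, rfl, rfl, h⟩
        exact h
    rw [this]
    refine MeasurableSet.biUnion (Set.countable_range _) fun t' _ => MeasurableSet.iUnion fun a => ?_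
    exact (ih t').inter ((measurable_fst (T.measurableSet_next t' a)).inter
      (measurable_snd (measurableSet_extend f t' t a)))

theorem measurableSet_halt (f : Cube d → ℝ) (a : Action d) :
    MeasurableSet {p : T.Seed × (ℕ → Cube d) | ∃ n, T.next p.1 (T.transcript f p.1 p.2 n) = a} := by
  have : {p : T.Seed × (ℕ → Cube d) | ∃ n, T.next p.1 (T.transcript f p.1 p.2 n) = a} =
      ⋃ n, ⋃ t' ∈ Set.range
        (List.map (Sum.elim (fun x => Answer.value (f x)) (Answer.point : Cube d → _))),
        {p | T.transcript f p.1 p.2 n = t'} ∩ Prod.fst ⁻¹' {ρ | T.next ρ t' = a} := by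
    ext p
    simp only [Set.mem_iUnion, Set.mem_inter_iff, Set.mem_preimage, Set.mem_ofPred_eq, exists_prop]
    constructor
    · rintro ⟨n, h⟩
      exact ⟨n, _, T.transcript_mem_range f p.1 p.2 n, rfl, h⟩
    · rintro ⟨n, t', _, rfl, h⟩
      exact ⟨n, h⟩
  rw [this]
  exact MeasurableSet.iUnion fun n => MeasurableSet.biUnion (Set.countable_range _) fun t' _ =>
    (T.measurableSet_transcript f n t').inter (measurable_fst (T.measurableSet_next t' a))

theorem numQueries_extend (f : Cube d → ℝ) (s : ℕ → Cube d) (t : List (Answer d)) (a : Action d) :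
    numQueries t ≤ numQueries (extend f s t a) := by
  cases a <;> simp [extend, numQueries]

theorem numQueries_mono (f : Cube d → ℝ) (ρ : T.Seed) (s : ℕ → Cube d) :
    Monotone fun n => numQueries (T.transcript f ρ s n) :=
  monotone_nat_of_le_succ fun n => by
    rw [transcript_succ]
    exact numQueries_extend _ _ _ _

open Classical in
/-- The points queried by a run before `Q` queries have been answered. -/
noncomputable def firstQueries (f : Cube d → ℝ) (ρ : T.Seed) (s : ℕ → Cube d) (Q : ℕ) :
    Finset (Cube d) :=
  Finset.univ.filter fun z => ∃ n, numQueries (T.transcript f ρ s n) < Q ∧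
    T.next ρ (T.transcript f ρ s n) = .query z

theorem mem_firstQueries {f : Cube d → ℝ} {ρ : T.Seed} {s : ℕ → Cube d} {Q : ℕ} {z : Cube d} :
    z ∈ T.firstQueries f ρ s Q ↔ ∃ n, numQueries (T.transcript f ρ s n) < Q ∧
      T.next ρ (T.transcript f ρ s n) = .query z := by
  simp [firstQueries]

/-- Label each queried point by the number of queries answered before some time at which it is
asked. The count rises with every query, so the labels are distinct and below Q. -/
theorem card_firstQueries_le (f : Cube d → ℝ) (ρ : T.Seed) (s : ℕ → Cube d) (Q : ℕ) :
    (T.firstQueries f ρ s Q).card ≤ Q := by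
  have hmem : ∀ z : Cube d, ∃ n, z ∈ T.firstQueries f ρ s Q →
      numQueries (T.transcript f ρ s n) < Q ∧ T.next ρ (T.transcript f ρ s n) = .query z := by
    intro z
    by_cases hz : z ∈ T.firstQueries f ρ s Q
    · obtain ⟨n, hn⟩ := T.mem_firstQueries.1 hz
      exact ⟨n, fun _ => hn⟩
    · exact ⟨0, fun h => absurd h hz⟩
  choose N hN using hmem
  have hlt : ∀ z ∈ T.firstQueries f ρ s Q, ∀ m, N z < m →
      numQueries (T.transcript f ρ s (N z)) < numQueries (T.transcript f ρ s m) := by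
    intro z hz m hm
    refine lt_of_lt_of_le ?_ (T.numQueries_mono f ρ s hm)
    simp only [Nat.succ_eq_add_one]
    rw [transcript_succ, (hN z hz).2]
    simp [extend, numQueries, Answer.isPoint]
  refine (Finset.card_le_card_of_injOn (t := Finset.range Q)
    (fun z => numQueries (T.transcript f ρ s (N z))) ?_ ?_).trans (Finset.card_range Q).le
  · intro z hz
    simpa using (hN z hz).1
  · intro z hz z' hz' h
    simp only at h
    rcases lt_trichotomy (N z) (N z') with hlt' | heq | hlt'
    · have := hlt z hz _ hlt'; omega
    · have h1 := (hN z hz).2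
      rw [heq, (hN z' hz').2] at h1
      injection h1 with h1
      exact h1.symm
    · have := hlt z' hz' _ hlt'; omega

/-- Two runs agree if the samples and the answers to the first queries do. -/
theorem transcript_eq_of_agree {f f' : Cube d → ℝ} {ρ : T.Seed} {s s' : ℕ → Cube d} {M Q : ℕ}
    (hM : ∀ n, numSamples (T.transcript f ρ s n) ≤ M)
    (hQ : ∀ n, numQueries (T.transcript f ρ s n) ≤ Q)
    (hs : ∀ j < M, s j = s' j) (hf : ∀ z ∈ T.firstQueries f' ρ s' Q, f z = f' z) (n : ℕ) :
    T.transcript f ρ s n = T.transcript f' ρ s' n := by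
  induction n with
  | zero => rfl
  | succ n ih =>
    have hM' := hM (n + 1)
    have hQ' := hQ (n + 1)
    rw [transcript_succ] at hM' hQ' ⊢
    rw [transcript_succ, ← ih]
    cases ha : T.next ρ (T.transcript f ρ s n) with
    | query z =>
      rw [ha] at hQ'
      have : f z = f' z := by
        -- This query counts towards `hQ'`, so fewer than Q precede it. Truncation at Q matters
        -- because the run on f' has no query bound of its own.
        refine hf z (T.mem_firstQueries.2 ⟨n, ?_, ih ▸ ha⟩)
        rw [← ih]
        simp only [extend, numQueries, List.countP_append, Answer.isPoint] at hQ'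
        exact hQ'
      simp [extend, this]
    | sample =>
      rw [ha] at hM'
      have : s (numSamples (T.transcript f ρ s n)) = s' (numSamples (T.transcript f ρ s n)) := by
        refine hs _ ?_
        simp only [extend, numSamples, List.countP_append, Answer.isPoint] at hM'
        exact hM'
      simp [extend, this]
    | accept => rfl
    | reject => rfl

theorem transcript_eq_of_halt {f : Cube d → ℝ} {ρ : T.Seed} {s : ℕ → Cube d} {n m : ℕ}
    (h : T.next ρ (T.transcript f ρ s n) = .accept ∨ T.next ρ (T.transcript f ρ s n) = .reject)
    (hnm : n ≤ m) : T.transcript f ρ s m = T.transcript f ρ s n := by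
  induction m, hnm using Nat.le_induction with
  | base => rfl
  | succ m _ ih =>
    rw [transcript_succ, ih]
    rcases h with h | h <;> rw [h] <;> rfl

theorem not_accept_and_reject {f : Cube d → ℝ} {ρ : T.Seed} {s : ℕ → Cube d}
    (ha : ∃ n, T.next ρ (T.transcript f ρ s n) = .accept)
    (hr : ∃ n, T.next ρ (T.transcript f ρ s n) = .reject) : False := by
  obtain ⟨n, hn⟩ := ha
  obtain ⟨m, hm⟩ := hr
  rcases le_total n m with h | h
  · rw [T.transcript_eq_of_halt (.inl hn) h, hn] at hm
    exact nomatch hm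
  · rw [T.transcript_eq_of_halt (.inr hm) h, hm] at hn
    exact nomatch hn

/-- Sampling through a map of a finite index set. -/
theorem runLaw_map {I : Type} [Finite I] [MeasurableSpace I] [MeasurableSingletonClass I]
    (μ : PMF I) (g : I → Cube d) :
    T.runLaw (μ.map g) = (T.seedLaw.prod (Measure.infinitePi fun _ : ℕ => μ.toMeasure)).map
      (Prod.map id fun ω j => g (ω j)) := by
  have hg : Measurable g := measurable_of_finite g
  have hG : Measurable fun (ω : ℕ → I) j => g (ω j) :=
    measurable_pi_lambda _ fun j => hg.comp (measurable_pi_apply j)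
  rw [runLaw, ← Measure.map_prod_map _ _ measurable_id hG, Measure.map_id,
    Measure.infinitePi_map_pi (μ := fun _ : ℕ => μ.toMeasure) (f := fun _ => g) fun _ => hg,
    PMF.toMeasure_map g μ hg]

/-- The complexity is integral or infinite and lies below ⌊x⌋₊ + 1, so almost every run stays at or
below ⌊x⌋₊. -/
theorem ae_numSamples_le {f : Cube d → ℝ} {D : PMF (Cube d)} {x : ℝ}
    (h : (T.sampleComplexity f D : ℝ≥0∞) < ENNReal.ofReal x) :
    ∀ᵐ p ∂T.runLaw D, ∀ n, numSamples (T.transcript f p.1 p.2 n) ≤ ⌊x⌋₊ := by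
  have h' : T.sampleComplexity f D < ((⌊x⌋₊ + 1 : ℕ) : ℕ∞) := by
    rw [← ENat.toENNReal_lt]
    refine h.trans_le ?_
    rw [ENat.toENNReal_coe]
    refine (ENNReal.ofReal_le_ofReal (q := ((⌊x⌋₊ + 1 : ℕ) : ℝ)) ?_).trans_eq
      (ENNReal.ofReal_natCast _)
    exact_mod_cast (Nat.lt_floor_add_one x).le
  filter_upwards [ae_lt_of_essSup_lt h'] with p hp n
  have := (le_iSup (fun n => (numSamples (T.transcript f p.1 p.2 n) : ℕ∞)) n).trans_lt hp
  exact Nat.lt_succ_iff.1 (by exact_mod_cast this)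

theorem ae_numQueries_le {f : Cube d → ℝ} {D : PMF (Cube d)} {x : ℝ}
    (h : (T.queryComplexity f D : ℝ≥0∞) < ENNReal.ofReal x) :
    ∀ᵐ p ∂T.runLaw D, ∀ n, numQueries (T.transcript f p.1 p.2 n) ≤ ⌊x⌋₊ := by
  have h' : T.queryComplexity f D < ((⌊x⌋₊ + 1 : ℕ) : ℕ∞) := by
    rw [← ENat.toENNReal_lt]
    refine h.trans_le ?_
    rw [ENat.toENNReal_coe]
    refine (ENNReal.ofReal_le_ofReal (q := ((⌊x⌋₊ + 1 : ℕ) : ℝ)) ?_).trans_eq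
      (ENNReal.ofReal_natCast _)
    exact_mod_cast (Nat.lt_floor_add_one x).le
  filter_upwards [ae_lt_of_essSup_lt h'] with p hp n
  have := (le_iSup (fun n => (numQueries (T.transcript f p.1 p.2 n) : ℕ∞)) n).trans_lt hp
  exact Nat.lt_succ_iff.1 (by exact_mod_cast this)

end Algorithm

/-! ### The hard instances -/

/-- A family of isometric copies ("cells") of the `n`-cube in the `d`-cube at mutual distance at
least `r`, with a common contraction onto the `n`-cube. -/
structure Cells (C : Type) (d n r : ℕ) where
  /-- The embedding of each cell. -/
  pt : C → Cube n → Cube d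
  /-- The contraction. -/
  proj : Cube d → Cube n
  dist_pt : ∀ c w w', hammingDist (pt c w) (pt c w') = hammingDist w w'
  le_dist_of_ne : ∀ c c' w w', c ≠ c' → r ≤ hammingDist (pt c w) (pt c' w')
  dist_proj_le : ∀ z c w, hammingDist (proj z) w ≤ hammingDist z (pt c w)

namespace Cells

variable {C : Type} {d n h : ℕ} (K : Cells C d n (2 * h))

/-- The apexes of the hard instance with parameters `u`, `Y`: in the cell `c`, the low apex is
`u c`, and the high one differs from it in the coordinates `Y`. -/
def apex (u : C → Cube n) (Y : Finset (Fin n)) (i : C × Bool) : Cube d :=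
  K.pt i.1 (if i.2 then u i.1 else flip (u i.1) Y)

theorem hammingDist_apex (u : C → Cube n) (Y : Finset (Fin n)) (c : C) :
    hammingDist (K.apex u Y (c, true)) (K.apex u Y (c, false)) = Y.card := by
  simp only [apex, K.dist_pt]
  exact hammingDist_flip _ _

/-- Ensures that no cone alters the value at an apex of the opposite kind, also when |Y| = 2h - 1
and low and high cones may interfere. -/
theorem le_hammingDist_apex (u : C → Cube n) {Y : Finset (Fin n)} (hY : h ≤ Y.card) (c c' : C) :
    h ≤ hammingDist (K.apex u Y (c, true)) (K.apex u Y (c', false)) := by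
  by_cases hc : c = c'
  · subst hc
    rwa [hammingDist_apex]
  · exact le_trans (by omega) (K.le_dist_of_ne c c' _ _ hc)

/-- The position of the apex singled out by `β` in each cell. -/
def visible (β : C → Bool) (Y : Finset (Fin n)) (u : C → Cube n) : C → Cube n :=
  fun c => if β c then u c else flip (u c) Y

/-- Being an involution in u for fixed β and Y, the passage to visible positions preserves counts;
this is what makes them independent of Y. -/
theorem visible_visible (β : C → Bool) (Y : Finset (Fin n)) (u : C → Cube n) :
    visible β Y (visible β Y u) = u := by
  funext c
  by_cases hc : β c <;> simp [visible, hc, flip_flip]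

theorem bump_image_congr {d h : ℕ} {ι κ : Type} (s : Finset ι) (t : Finset κ) (f : ι → Cube d)
    (g : κ → Cube d) (z : Cube d)
    (h1 : ∀ i ∈ s, hammingDist z (f i) < h → ∃ j ∈ t, g j = f i)
    (h2 : ∀ j ∈ t, hammingDist z (g j) < h → ∃ i ∈ s, f i = g j) :
    bump h (s.image f) z = bump h (t.image g) z := by
  unfold bump
  rw [Finset.sup_image, Finset.sup_image]
  refine le_antisymm (Finset.sup_le fun i hi => ?_) (Finset.sup_le fun j hj => ?_)
  · by_cases hz : hammingDist z (f i) < h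
    · obtain ⟨j, hj, hji⟩ := h1 i hi hz
      have := Finset.le_sup (f := (fun p => h - hammingDist z p) ∘ g) hj
      simpa only [Function.comp, hji] using this
    · simp only [Function.comp]; omega
  · by_cases hz : hammingDist z (g j) < h
    · obtain ⟨i, hi, hji⟩ := h2 j hj hz
      have := Finset.le_sup (f := (fun p => h - hammingDist z p) ∘ f) hi
      simpa only [Function.comp, hji] using this
    · simp only [Function.comp]; omega

/-- The side on which each cell is first seen among the samples `ω 0, …, ω (M - 1)`. -/
noncomputable def sides (M : ℕ) (ω : ℕ → C × Bool) (c : C) : Bool := by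
  classical
  -- The side of an unsampled cell is immaterial; without collisions the chosen index is the only
  -- one.
  exact if hc : ∃ j < M, (ω j).1 = c then (ω hc.choose).2 else true

theorem sides_apply {M : ℕ} {ω : ℕ → C × Bool}
    (hω : ∀ i < M, ∀ j < M, (ω i).1 = (ω j).1 → i = j) {j : ℕ} (hj : j < M) :
    sides M ω (ω j).1 = (ω j).2 := by
  have hc : ∃ i < M, (ω i).1 = (ω j).1 := ⟨j, hj, rfl⟩
  rw [sides, dif_pos hc]
  rw [hω _ hc.choose_spec.1 _ hj hc.choose_spec.2]

variable [Fintype C]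

/-- The function of the hard instance with parameters `u`, `Y`. -/
noncomputable def hardFn (u : C → Cube n) (Y : Finset (Fin n)) : Cube d → ℝ :=
  coneFn h (Finset.univ.image fun c => K.apex u Y (c, true))
    (Finset.univ.image fun c => K.apex u Y (c, false))

/-- The distribution of the hard instance: uniform on all apexes. -/
noncomputable def hardDist [Nonempty C] (u : C → Cube n) (Y : Finset (Fin n)) : PMF (Cube d) :=
  (PMF.uniformOfFintype (C × Bool)).map (K.apex u Y)

theorem isLip_hardFn (u : C → Cube n) {Y : Finset (Fin n)} (hY : Y.card = 2 * h) :
    IsLip (K.hardFn u Y) := by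
  refine isLip_coneFn ?_
  simp only [Finset.mem_image, Finset.mem_univ, true_and, forall_exists_index,
    forall_apply_eq_imp_iff]
  intro c c'
  by_cases hc : c = c'
  · subst hc
    rw [hammingDist_apex, hY]
  · exact K.le_dist_of_ne _ _ _ _ hc

theorem hardFn_low (u : C → Cube n) {Y : Finset (Fin n)} (hY : h ≤ Y.card) (c : C) :
    K.hardFn u Y (K.apex u Y (c, true)) = 0 := by
  rw [hardFn, coneFn, bump_eq_of_mem (Finset.mem_image_of_mem _ (Finset.mem_univ c)),
    bump_eq_zero]
  · simp
  · simp only [Finset.mem_image, Finset.mem_univ, true_and, forall_exists_index,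
      forall_apply_eq_imp_iff]
    exact fun c' => K.le_hammingDist_apex u hY c c'

theorem hardFn_high (u : C → Cube n) {Y : Finset (Fin n)} (hY : h ≤ Y.card) (c : C) :
    K.hardFn u Y (K.apex u Y (c, false)) = 2 * h := by
  rw [hardFn, coneFn,
    bump_eq_of_mem (S := Finset.univ.image fun c => K.apex u Y (c, false))
      (Finset.mem_image_of_mem _ (Finset.mem_univ c)), bump_eq_zero]
  · push_cast; ring
  · simp only [Finset.mem_image, Finset.mem_univ, true_and, forall_exists_index,
      forall_apply_eq_imp_iff]
    intro c'
    rw [hammingDist_comm]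
    exact K.le_hammingDist_apex u hY c' c

/-- In each cell the values 0 and 2h occur at distance less than 2h, so a Lipschitz g misses one of
the two apexes: half of the indices. -/
theorem half_le_distToLip [Nonempty C] (u : C → Cube n) {Y : Finset (Fin n)} (hY : h ≤ Y.card)
    (hY' : Y.card < 2 * h) : 1 / 2 ≤ distToLip (K.hardDist u Y) (K.hardFn u Y) := by
  classical
  refine le_iInf fun ⟨g, hg⟩ => ?_
  let : MeasurableSpace (C × Bool) := ⊤
  have hm : Measurable (K.apex u Y) := fun _ _ => trivial
  rw [hardDist, ← PMF.toMeasure_map _ _ hm, Measure.map_apply hm (Set.toFinite _).measurableSet,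
    PMF.toMeasure_uniformOfFintype_apply _ MeasurableSpace.measurableSet_top]
  have hpair : ∀ c, ∃ b, K.hardFn u Y (K.apex u Y (c, b)) ≠ g (K.apex u Y (c, b)) := by
    intro c
    by_contra! hc
    have h1 := hg (K.apex u Y (c, true)) (K.apex u Y (c, false))
    rw [← hc, ← hc, K.hardFn_low u hY, K.hardFn_high u hY, hypercube_dist, hammingDist_apex,
      zero_sub, abs_neg, abs_of_nonneg (by positivity)] at h1
    have : (2 * h : ℕ) ≤ Y.card := by exact_mod_cast h1
    omega
  choose b hb using hpair
  set S : Set (C × Bool) := K.apex u Y ⁻¹' {x | K.hardFn u Y x ≠ g x} with hS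
  have hcard : Fintype.card C ≤ Fintype.card S :=
    Fintype.card_le_of_injective (fun c => (⟨(c, b c), hb c⟩ : S))
      fun c c' hcc => congrArg (fun x : S => x.1.1) hcc
  have hC : (Fintype.card C : ℝ≥0∞) ≠ 0 := by simp
  calc (1 / 2 : ℝ≥0∞) = (Fintype.card C : ℝ≥0∞) / (Fintype.card (C × Bool) : ℕ) := by
        rw [Fintype.card_prod, Fintype.card_bool, Nat.cast_mul, Nat.cast_ofNat]
        conv_lhs => rw [← ENNReal.mul_div_mul_left 1 2 hC (by simp), mul_one]
    _ ≤ _ := by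
      gcongr

/-- The function showing only one apex in each cell: the low one where `β` is true, and the high
one elsewhere. -/
noncomputable def visibleFn (β : C → Bool) (v : C → Cube n) : Cube d → ℝ :=
  coneFn h ((Finset.univ.filter fun c => β c = true).image fun c => K.pt c (v c))
    ((Finset.univ.filter fun c => β c = false).image fun c => K.pt c (v c))

/-- Flipping a visible position by Y gives the hidden apex of the cell, whose cone vanishes at
distance h. -/
theorem hardFn_eq_visibleFn {β : C → Bool} {u : C → Cube n} {Y : Finset (Fin n)} {z : Cube d}
    (hz : ∀ c, h ≤ hammingDist z (K.pt c (flip (visible β Y u c) Y))) :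
    K.hardFn u Y z = K.visibleFn β (visible β Y u) z := by
  rw [hardFn, visibleFn, coneFn, coneFn]
  congr 2
  · congr 1
    refine bump_image_congr _ _ _ _ z ?_ ?_
    · intro c _ hc
      cases hβ : β c
      · have := hz c
        simp only [visible, hβ, Bool.false_eq_true, if_false, flip_flip] at this
        simp only [apex, if_true] at hc
        omega
      · exact ⟨c, by simp [hβ], by simp [apex, visible, hβ]⟩
    · intro c hc _
      exact ⟨c, by simp, by simp [apex, visible, (Finset.mem_filter.1 hc).2]⟩
  · refine bump_image_congr _ _ _ _ z ?_ ?_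
    · intro c _ hc
      cases hβ : β c
      · exact ⟨c, by simp [hβ], by simp [apex, visible, hβ]⟩
      · have := hz c
        simp only [visible, hβ, if_true] at this
        simp only [apex, Bool.false_eq_true, if_false] at hc
        omega
    · intro c hc _
      exact ⟨c, by simp, by simp [apex, visible, (Finset.mem_filter.1 hc).2]⟩

/-- Few shifts `Y` bring a hidden apex close to a given point. -/
theorem card_near_hidden_le (s : Finset (Finset (Fin n))) (v : C → Cube n) (z : Cube d) :
    (s.filter fun Y => ∃ c, hammingDist z (K.pt c (flip (v c) Y)) < h).card ≤
      ballCard n (h - 1) := by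
  by_cases hex : ∃ c Y, hammingDist z (K.pt c (flip (v c) Y)) < h
  · obtain ⟨c, Y, hc⟩ := hex
    refine (Finset.card_le_card ?_).trans (card_flip_near_le s (K.proj z) (v c))
    intro Z hZ
    obtain ⟨hZs, c', hc'⟩ := Finset.mem_filter.1 hZ
    -- Cells are 2h apart, so z is within less than h of only one of them, whatever Y is; no union
    -- bound over cells is needed.
    have hcc : c' = c := by
      by_contra hne
      have h1 := K.le_dist_of_ne c' c (flip (v c') Z) (flip (v c) Y) hne
      have h2 := hammingDist_triangle_left (K.pt c' (flip (v c') Z)) (K.pt c (flip (v c) Y)) z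
      omega
    subst hcc
    refine Finset.mem_filter.2 ⟨hZs, ?_⟩
    have := K.dist_proj_le z c' (flip (v c') Z)
    omega
  · push Not at hex
    rw [Finset.filter_false_of_mem]
    · simp
    · intro Y _
      push Not
      exact fun c => hex c Y

section Comparison

variable {C : Type} [Fintype C] [DecidableEq C] {d n h : ℕ} (K : Cells C d n (2 * h))
  (T : Algorithm.{u} d)

/-! ### Comparison with runs that only see one apex of each cell -/

open Classical in
/-- The positions `v` of the visible apexes for which the run with answers independent of the
hidden apexes ends with the action `a`. -/
noncomputable def visibleRuns (M : ℕ) (a : Action d) (p : T.Seed × (ℕ → C × Bool)) :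
    Finset (C → Cube n) :=
  Finset.univ.filter fun v => ∃ m, T.next p.1 (T.transcript (K.visibleFn (sides M p.2) v) p.1
    (fun j => K.pt (p.2 j).1 (v (p.2 j).1)) m) = a

/-- The runs on the hard instance with parameters `q` that end with the action `a`. -/
def hardRuns (a : Action d) (q : (C → Cube n) × Finset (Fin n)) :
    Set (T.Seed × (ℕ → C × Bool)) :=
  {p | ∃ m, T.next p.1 (T.transcript (K.hardFn q.1 q.2) p.1
    (fun j => K.apex q.1 q.2 (p.2 j)) m) = a}

/-- The runs on the hard instance with parameters `q` that draw at most `M` samples and make at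
most `Q` queries. -/
def boundedRuns (M Q : ℕ) (q : (C → Cube n) × Finset (Fin n)) :
    Set (T.Seed × (ℕ → C × Bool)) :=
  {p | (∀ m, numSamples (T.transcript (K.hardFn q.1 q.2) p.1
      (fun j => K.apex q.1 q.2 (p.2 j)) m) ≤ M) ∧
    ∀ m, numQueries (T.transcript (K.hardFn q.1 q.2) p.1
      (fun j => K.apex q.1 q.2 (p.2 j)) m) ≤ Q}

theorem card_visibleRuns_add_le (M : ℕ) (p : T.Seed × (ℕ → C × Bool)) :
    (K.visibleRuns T M .accept p).card + (K.visibleRuns T M .reject p).card ≤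
      Fintype.card (C → Cube n) := by
  rw [← Finset.card_union_of_disjoint]
  · exact Finset.card_le_univ _
  · rw [Finset.disjoint_left]
    intro v hv hv'
    simp only [visibleRuns, Finset.mem_filter] at hv hv'
    exact T.not_accept_and_reject hv.2 hv'.2

open Classical in
-- Change variables from (u, Y) to (v, Y) with v the visible positions. Either the visible run at v
-- behaves identically, or one of its first Q queries comes close to a hidden apex; the latter pairs
-- form `B`.
theorem card_hardRuns_le (M Q : ℕ) (a : Action d) (s : Finset (Finset (Fin n)))
    (p : T.Seed × (ℕ → C × Bool))
    (hp : ∀ i < M, ∀ j < M, (p.2 i).1 = (p.2 j).1 → i = j) :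
    ((Finset.univ ×ˢ s).filter fun q => p ∈ K.boundedRuns T M Q q ∩ K.hardRuns T a q).card ≤
      (K.visibleRuns T M a p).card * s.card +
        Fintype.card (C → Cube n) * (Q * ballCard n (h - 1)) := by
  set β := sides M p.2 with hβ
  let FQ : (C → Cube n) → Finset (Cube d) := fun v =>
    T.firstQueries (K.visibleFn β v) p.1 (fun j => K.pt (p.2 j).1 (v (p.2 j).1)) Q
  let B : Finset ((C → Cube n) × Finset (Fin n)) :=
    Finset.univ.biUnion fun v => (FQ v).biUnion fun z =>
      (s.filter fun Y => ∃ c, hammingDist z (K.pt c (flip (v c) Y)) < h).image (Prod.mk v)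
  have hB : B.card ≤ Fintype.card (C → Cube n) * (Q * ballCard n (h - 1)) := by
    refine Finset.card_biUnion_le_card_mul _ _ _ fun v _ => ?_
    refine (Finset.card_biUnion_le_card_mul _ _ _ fun z _ =>
      Finset.card_image_le.trans ?_).trans
      (Nat.mul_le_mul_right _ (T.card_firstQueries_le _ _ _ Q))
    convert K.card_near_hidden_le s v z
  have hsub : ((Finset.univ ×ˢ s).filter fun q =>
        p ∈ K.boundedRuns T M Q q ∩ K.hardRuns T a q) ⊆
      ((K.visibleRuns T M a p ×ˢ s) ∪ B).image fun q => (visible β q.2 q.1, q.2) := by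
    rintro ⟨u, Y⟩ hq
    obtain ⟨hs, ⟨hM, hQ⟩, hH⟩ := Finset.mem_filter.1 hq
    have hY : Y ∈ s := (Finset.mem_product.1 hs).2
    refine Finset.mem_image.2 ⟨(visible β Y u, Y), ?_, by simp [visible_visible]⟩
    by_cases hb : ∃ z ∈ FQ (visible β Y u), ∃ c,
        hammingDist z (K.pt c (flip (visible β Y u c) Y)) < h
    · obtain ⟨z, hz, hc⟩ := hb
      refine Finset.mem_union_right _ (Finset.mem_biUnion.2 ⟨visible β Y u, Finset.mem_univ _,
        Finset.mem_biUnion.2 ⟨z, hz, Finset.mem_image.2 ⟨Y, Finset.mem_filter.2 ⟨hY, hc⟩, rfl⟩⟩⟩)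
    · push Not at hb
      refine Finset.mem_union_left _ (Finset.mem_product.2 ⟨?_, hY⟩)
      have key := T.transcript_eq_of_agree (f' := K.visibleFn β (visible β Y u))
        (s' := fun j => K.pt (p.2 j).1 (visible β Y u (p.2 j).1)) hM hQ ?_ ?_
      · simp only [hardRuns, Set.mem_ofPred_eq] at hH
        obtain ⟨m, hm⟩ := hH
        simp only [visibleRuns, Finset.mem_filter, Finset.mem_univ, true_and]
        exact ⟨m, by rw [← hβ, ← key m]; exact hm⟩
      · intro j hj
        simp only [apex, visible, hβ, sides_apply hp hj]
      · intro z hz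
        exact K.hardFn_eq_visibleFn (hb z hz)
  refine (Finset.card_le_card hsub).trans (Finset.card_image_le.trans
    ((Finset.card_union_le _ _).trans ?_))
  rw [Finset.card_product]
  exact Nat.add_le_add_left hB _

end Comparison

/-! ### Averaging over the instances -/

section Averaging

variable {C : Type} [Fintype C] {d n h : ℕ} (K : Cells C d n (2 * h)) (T : Algorithm.{u} d)
  [MeasurableSpace C] [MeasurableSingletonClass C]

theorem measurable_apex_seq (u : C → Cube n) (Y : Finset (Fin n)) :
    Measurable (Prod.map id fun (ω : ℕ → C × Bool) j => K.apex u Y (ω j) :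
      T.Seed × (ℕ → C × Bool) → T.Seed × (ℕ → Cube d)) :=
  measurable_id.prodMap (measurable_pi_lambda _ fun j =>
    (measurable_of_finite (K.apex u Y)).comp (measurable_pi_apply j))

theorem measurableSet_hardRuns (a : Action d) (q : (C → Cube n) × Finset (Fin n)) :
    MeasurableSet (K.hardRuns T a q) :=
  K.measurable_apex_seq T q.1 q.2 (T.measurableSet_halt (K.hardFn q.1 q.2) a)

/-- The event that some cell is sampled twice among the first `M` samples. -/
def collision (C : Type) (M : ℕ) : Set (T.Seed × (ℕ → C × Bool)) :=
  ⋃ i ∈ Finset.range M, ⋃ j ∈ (Finset.range M).erase i, {p | (p.2 i).1 = (p.2 j).1}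

theorem measurableSet_same_cell (i j : ℕ) :
    MeasurableSet {p : T.Seed × (ℕ → C × Bool) | (p.2 i).1 = (p.2 j).1} := by
  have hm : Measurable fun p : T.Seed × (ℕ → C × Bool) => ((p.2 i).1, (p.2 j).1) := by fun_prop
  exact hm (Set.toFinite {x : C × C | x.1 = x.2}).measurableSet

theorem measurableSet_collision (M : ℕ) : MeasurableSet (collision T C M) :=
  Finset.measurableSet_biUnion _ fun i _ => Finset.measurableSet_biUnion _ fun j _ =>
    measurableSet_same_cell T i j

variable [Nonempty C]

/-- The law of the seed and of the indices of the sampled apexes. -/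
noncomputable def indexLaw (C : Type) [Fintype C] [Nonempty C] [MeasurableSpace C] :
    Measure (T.Seed × (ℕ → C × Bool)) :=
  T.seedLaw.prod (Measure.infinitePi fun _ : ℕ => (PMF.uniformOfFintype (C × Bool)).toMeasure)

instance isProbabilityMeasure_indexLaw : IsProbabilityMeasure (indexLaw T C) := by
  unfold indexLaw; infer_instance

theorem indexLaw_hardRuns (a : Action d) (q : (C → Cube n) × Finset (Fin n)) :
    indexLaw T C (K.hardRuns T a q) = T.runLaw (K.hardDist q.1 q.2)
      {p | ∃ m, T.next p.1 (T.transcript (K.hardFn q.1 q.2) p.1 p.2 m) = a} := by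
  rw [hardDist, T.runLaw_map, Measure.map_apply (K.measurable_apex_seq T q.1 q.2)
    (T.measurableSet_halt _ a)]
  rfl

theorem ae_mem_boundedRuns {x y : ℝ} (q : (C → Cube n) × Finset (Fin n))
    (hx : (T.sampleComplexity (K.hardFn q.1 q.2) (K.hardDist q.1 q.2) : ℝ≥0∞) < ENNReal.ofReal x)
    (hy : (T.queryComplexity (K.hardFn q.1 q.2) (K.hardDist q.1 q.2) : ℝ≥0∞) < ENNReal.ofReal y) :
    ∀ᵐ p ∂indexLaw T C, p ∈ K.boundedRuns T ⌊x⌋₊ ⌊y⌋₊ q := by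
  have h1 := T.ae_numSamples_le hx
  have h2 := T.ae_numQueries_le hy
  rw [hardDist, T.runLaw_map] at h1 h2
  filter_upwards [ae_of_ae_map (K.measurable_apex_seq T q.1 q.2).aemeasurable h1,
    ae_of_ae_map (K.measurable_apex_seq T q.1 q.2).aemeasurable h2] with p hp1 hp2
  exact ⟨hp1, hp2⟩

theorem indexLaw_same_cell_le {i j : ℕ} (hij : i ≠ j) :
    indexLaw T C {p | (p.2 i).1 = (p.2 j).1} ≤ (Fintype.card C : ℝ≥0∞)⁻¹ := by
  classical
  set μ := (PMF.uniformOfFintype (C × Bool)).toMeasure with hμ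
  have hC : (Fintype.card C : ℝ≥0∞) ≠ 0 := by simp
  have hcell : ∀ c : C, μ {x | x.1 = c} = (Fintype.card C : ℝ≥0∞)⁻¹ := by
    intro c
    have hms : MeasurableSet {x : C × Bool | x.1 = c} := (Set.toFinite _).measurableSet
    have hc : Fintype.card {x : C × Bool | x.1 = c} = 2 := by
      rw [← Fintype.card_bool]
      refine Fintype.card_congr ⟨fun x => x.1.2, fun b => ⟨(c, b), rfl⟩, ?_, fun _ => rfl⟩
      rintro ⟨⟨c', b⟩, rfl⟩
      rfl
    rw [hμ, PMF.toMeasure_uniformOfFintype_apply _ hms, hc, Fintype.card_prod, Fintype.card_bool,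
      mul_comm, Nat.cast_mul, Nat.cast_ofNat]
    conv_lhs => rw [show (2 : ℝ≥0∞) / (2 * Fintype.card C) = 2 * 1 / (2 * Fintype.card C) by
      rw [mul_one], ENNReal.mul_div_mul_left _ _ (by simp) (by simp), one_div]
  -- Splitting by the common cell turns the event into cylinders, whose product measure is explicit.
  have hset : {p : T.Seed × (ℕ → C × Bool) | (p.2 i).1 = (p.2 j).1} =
      Set.univ ×ˢ ⋃ c : C, Set.pi (({i, j} : Finset ℕ) : Set ℕ) fun _ => {x : C × Bool | x.1 = c} := by
    ext p
    simp [eq_comm]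
  rw [hset, indexLaw, Measure.prod_prod, measure_univ, one_mul, ← hμ]
  refine (measure_iUnion_fintype_le _ _).trans ?_
  have hpi : ∀ c : C, (Measure.infinitePi fun _ : ℕ => μ)
      (Set.pi (({i, j} : Finset ℕ) : Set ℕ) fun _ => {x : C × Bool | x.1 = c}) =
        (Fintype.card C : ℝ≥0∞)⁻¹ * (Fintype.card C : ℝ≥0∞)⁻¹ := by
    intro c
    rw [Measure.infinitePi_pi _ fun _ _ => (Set.toFinite _).measurableSet,
      Finset.prod_pair hij, hcell]
  simp only [hpi, Finset.sum_const, Finset.card_univ, nsmul_eq_mul]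
  rw [← mul_assoc, ENNReal.mul_inv_cancel hC (by simp), one_mul]

theorem indexLaw_collision_le (M : ℕ) :
    indexLaw T C (collision T C M) ≤ (M : ℝ≥0∞) ^ 2 * (Fintype.card C : ℝ≥0∞)⁻¹ := by
  calc indexLaw T C (collision T C M)
      ≤ ∑ i ∈ Finset.range M, ∑ j ∈ (Finset.range M).erase i, (Fintype.card C : ℝ≥0∞)⁻¹ := by
        refine (measure_biUnion_finset_le _ _).trans (Finset.sum_le_sum fun i _ => ?_)
        refine (measure_biUnion_finset_le _ _).trans (Finset.sum_le_sum fun j hj => ?_)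
        exact indexLaw_same_cell_le T (Finset.ne_of_mem_erase hj).symm
    _ ≤ ∑ i ∈ Finset.range M, ∑ j ∈ Finset.range M, (Fintype.card C : ℝ≥0∞)⁻¹ :=
        Finset.sum_le_sum fun i _ => Finset.sum_le_sum_of_subset (Finset.erase_subset _ _)
    _ = _ := by
        simp only [Finset.sum_const, Finset.card_range, nsmul_eq_mul]
        ring

/-- If all hard instances with shifts in `s` end with the action `a` with probability at least
`2/3`, then so do the runs that only see one apex of each cell, up to a small error. -/
theorem le_lintegral_visibleRuns [DecidableEq C] (M Q : ℕ) (a : Action d) (s : Finset (Finset (Fin n)))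
    (hs : s.Nonempty) (hb : ∀ u, ∀ Y ∈ s, ∀ᵐ p ∂indexLaw T C, p ∈ K.boundedRuns T M Q (u, Y))
    (ha : ∀ u, ∀ Y ∈ s, 2 / 3 ≤ indexLaw T C (K.hardRuns T a (u, Y))) :
    2 / 3 ≤ ∫⁻ p, ((K.visibleRuns T M a p).card : ℝ≥0∞) / Fintype.card (C → Cube n) ∂indexLaw T C +
      ((Q * ballCard n (h - 1) : ℕ) : ℝ≥0∞) / s.card + indexLaw T C (collision T C M) := by
  classical
  set P := indexLaw T C with hP
  set U : ℝ≥0∞ := ((Fintype.card (C → Cube n) : ℕ) : ℝ≥0∞) with hU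
  have hU0 : U ≠ 0 := by simp [hU]
  have hUt : U ≠ ⊤ := by simp [hU]
  have hs0 : (s.card : ℝ≥0∞) ≠ 0 := by simpa using hs.ne_empty
  have hst : (s.card : ℝ≥0∞) ≠ ⊤ := by simp
  have hall : ∀ᵐ p ∂P, ∀ q ∈ (Finset.univ : Finset (C → Cube n)) ×ˢ s,
      p ∈ K.boundedRuns T M Q q := by
    rw [Filter.eventually_all_finset]
    exact fun q hq => hb q.1 q.2 (Finset.mem_product.1 hq).2
  -- Fix seed and sample indices and average over the instances: the counting bound applies off
  -- collisions, and the trivial bound on them.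
  have hpt : ∀ᵐ p ∂P, ∑ q ∈ (Finset.univ : Finset (C → Cube n)) ×ˢ s,
      (K.hardRuns T a q).indicator (fun _ => (1 : ℝ≥0∞)) p ≤
      U * s.card * (((K.visibleRuns T M a p).card : ℝ≥0∞) / U +
        ((Q * ballCard n (h - 1) : ℕ) : ℝ≥0∞) / s.card +
        (collision T C M).indicator (fun _ => 1) p) := by
    filter_upwards [hall] with p hp
    have hsum : ∑ q ∈ (Finset.univ : Finset (C → Cube n)) ×ˢ s,
        (K.hardRuns T a q).indicator (fun _ => (1 : ℝ≥0∞)) p =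
        (((Finset.univ ×ˢ s).filter fun q =>
          p ∈ K.boundedRuns T M Q q ∩ K.hardRuns T a q).card : ℝ≥0∞) := by
      rw [Finset.card_filter, Nat.cast_sum]
      refine Finset.sum_congr rfl fun q hq => ?_
      by_cases hpa : p ∈ K.hardRuns T a q <;> simp [hpa, hp q hq]
    rw [hsum]
    by_cases hc : p ∈ collision T C M
    · calc _ ≤ U * s.card := by
            rw [hU, ← Nat.cast_mul]
            refine Nat.cast_le.2 ((Finset.card_filter_le _ _).trans ?_)
            rw [Finset.card_product, Finset.card_univ]
        _ ≤ _ := by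
            rw [Set.indicator_of_mem hc]
            exact le_mul_of_one_le_right zero_le le_add_self
    · have hinj : ∀ i < M, ∀ j < M, (p.2 i).1 = (p.2 j).1 → i = j := by
        intro i hi j hj hij
        by_contra hne
        refine hc (Set.mem_biUnion (Finset.mem_coe.2 (Finset.mem_range.2 hi))
          (Set.mem_biUnion (Finset.mem_coe.2 (Finset.mem_erase.2 ⟨Ne.symm hne,
            Finset.mem_range.2 hj⟩)) hij))
      refine (Nat.cast_le.2 (K.card_hardRuns_le T M Q a s p hinj)).trans ?_
      rw [Set.indicator_of_notMem hc, add_zero, mul_add]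
      refine le_of_eq ?_
      push_cast
      congr 1
      · rw [mul_comm U, mul_assoc, ENNReal.mul_div_cancel hU0 hUt, mul_comm]
      · rw [mul_assoc, ENNReal.mul_div_cancel hs0 hst]
  have hint := lintegral_mono_ae hpt
  rw [lintegral_finsetSum _ fun q _ => measurable_const.indicator (K.measurableSet_hardRuns T a q),
    lintegral_const_mul' _ _ (ENNReal.mul_ne_top hUt hst),
    lintegral_add_right _ (measurable_const.indicator (measurableSet_collision T M)),
    lintegral_add_right _ measurable_const,
    lintegral_indicator_const (measurableSet_collision T M), lintegral_const, measure_univ] at hint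
  simp only [lintegral_indicator_const (K.measurableSet_hardRuns T a _), one_mul, mul_one] at hint
  have hlow : U * s.card * (2 / 3) ≤ ∑ q ∈ (Finset.univ : Finset (C → Cube n)) ×ˢ s,
      P (K.hardRuns T a q) := by
    have := Finset.card_nsmul_le_sum ((Finset.univ : Finset (C → Cube n)) ×ˢ s)
      (fun q => P (K.hardRuns T a q)) (2 / 3)
      fun q hq => ha q.1 q.2 (Finset.mem_product.1 hq).2
    rwa [Finset.card_product, Finset.card_univ, nsmul_eq_mul, Nat.cast_mul] at this
  exact (ENNReal.mul_le_mul_iff_right (mul_ne_zero hU0 hs0) (ENNReal.mul_ne_top hUt hst)).1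
    (hlow.trans hint)

end Averaging

end Cells

/-! ### Cells from a code -/

theorem hammingDist_append {m n : ℕ} (a a' : Cube m) (b b' : Cube n) :
    hammingDist (Fin.append a b : Cube (m + n)) (Fin.append a' b') =
      hammingDist a a' + hammingDist b b' := by
  unfold hammingDist
  simp only [Finset.card_filter, Fin.sum_univ_add, Fin.append_left, Fin.append_right]

/-- A cell fixes the first m coordinates to a codeword; the contraction forgets them. -/
theorem exists_cells {m n d r : ℕ} (hd : m + n = d) (C : Finset (Cube m))
    (hC : ∀ x ∈ C, ∀ y ∈ C, x ≠ y → r ≤ hammingDist x y) : Nonempty (Cells C d n r) := by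
  subst hd
  refine ⟨⟨fun c w => Fin.append c.1 w, fun z i => z (Fin.natAdd m i), ?_, ?_, ?_⟩⟩
  · intro c w w'
    rw [hammingDist_append, hammingDist_self, zero_add]
  · intro c c' w w' hcc
    rw [hammingDist_append]
    exact (hC _ c.2 _ c'.2 fun h => hcc (Subtype.ext h)).trans (Nat.le_add_right _ _)
  · intro z c w
    have hz : z = Fin.append (fun i => z (Fin.castAdd n i)) fun i => z (Fin.natAdd m i) :=
      (Fin.append_castAdd_natAdd (f := z)).symm
    conv_rhs => rw [hz]
    rw [hammingDist_append]
    exact Nat.le_add_left _ _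

/-! ### Estimates -/

/-- Induct by the absorption identity; n/k only decreases when both terms grow by 1, as k ≤ n. -/
theorem div_pow_le_choose (k n : ℕ) (hk : k ≤ n) : ((n : ℝ) / k) ^ k ≤ n.choose k := by
  induction k generalizing n with
  | zero => simp
  | succ k ih =>
    obtain ⟨n, rfl⟩ : ∃ m, n = m + 1 := ⟨n - 1, by omega⟩
    have hkn : k ≤ n := by omega
    have hc : ((n + 1 : ℕ).choose (k + 1) : ℝ) = ((n + 1 : ℕ) : ℝ) / (k + 1 : ℕ) * n.choose k := by
      have := Nat.add_one_mul_choose_eq n k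
      have h' : ((n : ℝ) + 1) * n.choose k = (n + 1).choose (k + 1) * ((k : ℝ) + 1) := by
        exact_mod_cast this
      push_cast
      field_simp
      linarith
    rw [hc, pow_succ, mul_comm]
    refine mul_le_mul_of_nonneg_left (le_trans ?_ (ih n hkn)) (by positivity)
    rcases Nat.eq_zero_or_pos k with rfl | hk0
    · simp
    refine pow_le_pow_left₀ (by positivity) ?_ k
    have h1 : (0 : ℝ) < k := by exact_mod_cast hk0
    have h2 : (k : ℝ) ≤ n := by exact_mod_cast hkn
    rw [div_le_div_iff₀ (by positivity) h1]
    push_cast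
    nlinarith

/-- Few queries do not find a hidden apex. -/
theorem queries_mul_ballCard_le {d h k : ℕ} (hh : 2 ≤ h) (hd : 65536 * (2 * h) ≤ d)
    (hk : 2 * h - 1 ≤ k) (hk' : k ≤ 2 * h) :
    24 * (⌊((d : ℝ) / ((2 * h : ℕ) : ℝ)) ^ ((1 / 16 : ℝ) * ((2 * h : ℕ) : ℝ))⌋₊ *
      ballCard (d - d / 2) (h - 1)) ≤ (d - d / 2).choose k := by
  set n := d - d / 2 with hn
  set t : ℝ := (n : ℝ) / (2 * h : ℕ) with ht
  have hh0 : (0 : ℝ) < (2 * h : ℕ) := by exact_mod_cast (by omega : 0 < 2 * h)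
  have hnd : (d : ℝ) ≤ 2 * n := by exact_mod_cast (by omega : d ≤ 2 * n)
  have ht0 : (10000 : ℝ) ≤ t := by
    rw [ht, le_div_iff₀ hh0]
    exact_mod_cast (by omega : 10000 * (2 * h) ≤ n)
  have htpos : 0 < t := by linarith
  have hchoose : t ^ (2 * h - 1) ≤ n.choose k := by
    refine le_trans ?_ (div_pow_le_choose k n (by omega))
    refine (pow_le_pow_right₀ (by linarith) hk).trans (pow_le_pow_left₀ htpos.le ?_ k)
    have hk0 : (0 : ℝ) < k := by exact_mod_cast (by omega : 0 < k)
    exact div_le_div_of_nonneg_left (by positivity) hk0 (by exact_mod_cast hk')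
  -- Take x = 1/t in the generating function: (1 + 1/t)^n ≤ exp(n/t) = exp(2h).
  have hball : (ballCard n (h - 1) : ℝ) ≤ Real.exp 2 ^ h * t ^ (h - 1) := by
    have h1 := ballCard_mul_pow_le n (h - 1) (inv_pos.2 htpos) (inv_le_one_of_one_le₀ (by linarith))
    have h2 : (1 + t⁻¹) ^ n ≤ Real.exp 2 ^ h := by
      have : 1 + t⁻¹ ≤ Real.exp t⁻¹ := by linarith [Real.add_one_le_exp t⁻¹]
      refine (pow_le_pow_left₀ (by positivity) this n).trans_eq ?_
      rw [← Real.exp_nat_mul, ← Real.exp_nat_mul]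
      congr 1
      have hn0 : (n : ℝ) ≠ 0 := by
        intro h0
        rw [ht, h0, zero_div] at htpos
        exact lt_irrefl _ htpos
      rw [ht]
      push_cast
      field_simp
    rw [inv_pow, ← div_eq_mul_inv, div_le_iff₀ (by positivity)] at h1
    exact h1.trans (mul_le_mul_of_nonneg_right h2 (by positivity))
  -- The base is at most t^4 and the exponent is h/8, giving t^(h/2). The other half power of t
  -- absorbs 24·exp(2h).
  have hQ : ((d : ℝ) / ((2 * h : ℕ) : ℝ)) ^ ((1 / 16 : ℝ) * ((2 * h : ℕ) : ℝ)) ≤ Real.sqrt t ^ h := by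
    have h1 : (d : ℝ) / ((2 * h : ℕ) : ℝ) ≤ t ^ (4 : ℝ) := by
      calc (d : ℝ) / ((2 * h : ℕ) : ℝ) ≤ 2 * t := by
            rw [ht, ← mul_div_assoc]
            gcongr
        _ ≤ t * t := by gcongr; linarith
        _ = t ^ 2 := by ring
        _ ≤ t ^ 4 := pow_le_pow_right₀ (by linarith) (by norm_num)
        _ = t ^ (4 : ℝ) := by norm_cast
    refine (Real.rpow_le_rpow (by positivity) h1 (by positivity)).trans_eq ?_
    rw [← Real.rpow_mul htpos.le, Real.sqrt_eq_rpow, ← Real.rpow_natCast, ← Real.rpow_mul htpos.le]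
    congr 1
    push_cast
    ring
  have hsqrt : 5 * Real.exp 2 ≤ Real.sqrt t := by
    have h1 : (100 : ℝ) ≤ Real.sqrt t := Real.le_sqrt_of_sq_le (by linarith)
    have h2 : Real.exp 2 ≤ 9 := by
      have h3 := Real.exp_one_lt_d9
      have h4 : Real.exp 2 = Real.exp 1 * Real.exp 1 := by rw [← Real.exp_add]; norm_num
      have h5 := Real.exp_pos 1
      rw [h4]
      nlinarith
    linarith
  have h24 : (24 : ℝ) * Real.exp 2 ^ h ≤ Real.sqrt t ^ h := by
    have h1 : (24 : ℝ) ≤ 5 ^ h := by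
      calc (24 : ℝ) ≤ 5 ^ 2 := by norm_num
        _ ≤ 5 ^ h := pow_le_pow_right₀ (by norm_num) hh
    calc (24 : ℝ) * Real.exp 2 ^ h ≤ 5 ^ h * Real.exp 2 ^ h := by gcongr
      _ = (5 * Real.exp 2) ^ h := (mul_pow _ _ _).symm
      _ ≤ _ := pow_le_pow_left₀ (by positivity) hsqrt h
  have hfinal : (24 : ℝ) * ((⌊((d : ℝ) / ((2 * h : ℕ) : ℝ)) ^ ((1 / 16 : ℝ) * ((2 * h : ℕ) : ℝ))⌋₊ : ℝ) *
      ballCard n (h - 1)) ≤ n.choose k := by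
    calc _ ≤ 24 * (Real.sqrt t ^ h * (Real.exp 2 ^ h * t ^ (h - 1))) := by
          gcongr
          exact (Nat.floor_le (by positivity)).trans hQ
      _ = (24 * Real.exp 2 ^ h) * Real.sqrt t ^ h * t ^ (h - 1) := by ring
      _ ≤ Real.sqrt t ^ h * Real.sqrt t ^ h * t ^ (h - 1) := by gcongr
      _ = t ^ (2 * h - 1) := by
          rw [← mul_pow, Real.mul_self_sqrt htpos.le, ← pow_add]
          congr 1
          omega
      _ ≤ _ := hchoose
  exact_mod_cast hfinal

/-- Few samples do not hit a cell twice. -/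
theorem samples_sq_le {d r N : ℕ} (hr : 4 ≤ r) (hd : 65536 * r ≤ d)
    (hN : 2 ^ (d / 2) ≤ N * ballCard (d / 2) (r - 1)) :
    24 * ⌊(2 : ℝ) ^ ((1 / 16 : ℝ) * (d : ℝ))⌋₊ ^ 2 ≤ N := by
  have hM : ⌊(2 : ℝ) ^ ((1 / 16 : ℝ) * (d : ℝ))⌋₊ ≤ 2 ^ (d / 16 + 1) := by
    refine Nat.floor_le_of_le ?_
    push_cast
    rw [← Real.rpow_natCast]
    refine Real.rpow_le_rpow_of_exponent_le (by norm_num) ?_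
    have : (d : ℝ) ≤ 16 * (d / 16 + 1 : ℕ) := by
      exact_mod_cast (by omega : d ≤ 16 * (d / 16 + 1))
    linarith
  have h1 : 24 * ⌊(2 : ℝ) ^ ((1 / 16 : ℝ) * (d : ℝ))⌋₊ ^ 2 ≤ 2 ^ (5 + 2 * (d / 16 + 1)) := by
    rw [pow_add, pow_mul']
    exact Nat.mul_le_mul (by norm_num) (Nat.pow_le_pow_left hM 2)
  refine h1.trans ?_
  -- With x = 1/4 the code has size at least (8/5)^(d/2) / 4^(r-1), and (8/5)^2 ≥ 2 leaves about
  -- 2^(d/4); 4^(r-1) is negligible since r is tiny against d.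
  have hb := ballCard_mul_pow_le (d / 2) (r - 1) (x := 1 / 4) (by norm_num) (by norm_num)
  have h4 : (0 : ℝ) < 4 ^ (r - 1) := by positivity
  rw [one_div, inv_pow, ← div_eq_mul_inv, div_le_iff₀ h4] at hb
  have hN' : (2 : ℝ) ^ (d / 2) ≤ N * ballCard (d / 2) (r - 1) := by exact_mod_cast hN
  have h2 : (2 : ℝ) ^ (d / 2) ≤ N * ((5 / 4) ^ (d / 2) * 4 ^ (r - 1)) := by
    refine hN'.trans (mul_le_mul_of_nonneg_left (hb.trans_eq ?_) (by positivity))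
    norm_num
  have h3 : (2 : ℝ) ^ (d / 2) = (8 / 5) ^ (d / 2) * (5 / 4) ^ (d / 2) := by
    rw [← mul_pow]; norm_num
  have h5 : ((8 : ℝ) / 5) ^ (d / 2) ≤ N * 4 ^ (r - 1) := by
    rw [h3] at h2
    have h6 : (0 : ℝ) < (5 / 4) ^ (d / 2) := by positivity
    refine le_of_mul_le_mul_right (h2.trans_eq ?_) h6
    ring
  have h7 : (2 : ℝ) ^ (d / 2 / 2) ≤ (8 / 5) ^ (d / 2) := by
    calc (2 : ℝ) ^ (d / 2 / 2) ≤ ((8 / 5) ^ 2) ^ (d / 2 / 2) :=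
          pow_le_pow_left₀ (by norm_num) (by norm_num) _
      _ = (8 / 5) ^ (2 * (d / 2 / 2)) := (pow_mul _ _ _).symm
      _ ≤ (8 / 5) ^ (d / 2) := pow_le_pow_right₀ (by norm_num) (by omega)
  have h8 : (2 : ℝ) ^ (5 + 2 * (d / 16 + 1)) * 4 ^ (r - 1) ≤ 2 ^ (d / 2 / 2) := by
    rw [show (4 : ℝ) = 2 ^ 2 by norm_num, ← pow_mul, ← pow_add]
    exact pow_le_pow_right₀ (by norm_num) (by omega)
  have h9 : (2 : ℝ) ^ (5 + 2 * (d / 16 + 1)) ≤ N :=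
    le_of_mul_le_mul_right ((h8.trans h7).trans h5) h4
  exact_mod_cast h9

theorem natCast_div_le_of_mul_le {a b k : ℕ} (hk : k ≠ 0) (hb : b ≠ 0) (h : k * a ≤ b) :
    (a : ℝ≥0∞) / b ≤ 1 / k := by
  rw [ENNReal.div_le_iff (by exact_mod_cast hb) (by simp), one_div]
  calc (a : ℝ≥0∞) = (k : ℝ≥0∞)⁻¹ * (k * a) := by
        rw [← mul_assoc, ENNReal.inv_mul_cancel (by exact_mod_cast hk) (by simp), one_mul]
    _ ≤ (k : ℝ≥0∞)⁻¹ * b := by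
        gcongr
        exact_mod_cast h

end LipschitzTesting

/-! ### ### The lower bound -/

theorem mainTheorem4 :
    ∃ c : ℝ, 0 < c ∧ ∃ d₀ : ℕ, ∀ d : ℕ, d₀ ≤ d →
      ∀ r : ℕ, Even r → 4 ≤ r → (r : ℝ) ≤ (2 : ℝ) ^ (-16 : ℤ) * (d : ℝ) →
        ∀ T : LipschitzTesting.Algorithm.{u} d,
          T.IsDistributionFreeLipTester (r : ℝ) (1 / 2) →
            ∃ (f : LipschitzTesting.Cube d → ℝ) (D : PMF (LipschitzTesting.Cube d)),
              (∀ x, f x ∈ Set.Icc (0 : ℝ) (r : ℝ)) ∧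
              (ENNReal.ofReal ((2 : ℝ) ^ (c * (d : ℝ))) ≤ (T.sampleComplexity f D : ENNReal) ∨
                ENNReal.ofReal (((d : ℝ) / (r : ℝ)) ^ (c * (r : ℝ))) ≤
                  (T.queryComplexity f D : ENNReal)) := by
  open LipschitzTesting in
  -- No threshold on d is needed: 4 ≤ r ≤ 2^(-16) d already forces d to be large.
  refine ⟨1 / 16, by norm_num, 0, fun d _ r hev hr4 hrd T hT => ?_⟩
  obtain ⟨h, rfl⟩ : ∃ h, r = 2 * h := hev.exists_two_nsmul.imp fun h hh => by simpa using hh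
  have hd : 65536 * (2 * h) ≤ d := by
    have : (65536 : ℝ) * ((2 * h : ℕ) : ℝ) ≤ d := by
      norm_num [zpow_neg] at hrd ⊢
      linarith
    exact_mod_cast this
  by_contra! hcon
  obtain ⟨C, hC, hCcard⟩ := exists_code (d / 2) (2 * h)
  obtain ⟨K⟩ := exists_cells (n := d - d / 2) (by omega : d / 2 + (d - d / 2) = d) C hC
  have hCpos : C.card ≠ 0 := by
    intro h0
    rw [h0, zero_mul] at hCcard
    exact absurd hCcard (not_le.2 (by positivity))
  have : Nonempty C := (Finset.card_pos.1 (Nat.pos_of_ne_zero hCpos)).to_subtype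
  set M := ⌊(2 : ℝ) ^ ((1 / 16 : ℝ) * (d : ℝ))⌋₊ with hM
  set Q := ⌊((d : ℝ) / ((2 * h : ℕ) : ℝ)) ^ ((1 / 16 : ℝ) * ((2 * h : ℕ) : ℝ))⌋₊ with hQ
  have hIcc : ∀ u Y x, K.hardFn u Y x ∈ Set.Icc (0 : ℝ) ((2 * h : ℕ) : ℝ) :=
    fun u Y x => coneFn_mem_Icc _ _ x
  have hbd : ∀ u Y, ∀ᵐ p ∂Cells.indexLaw T C, p ∈ K.boundedRuns T M Q (u, Y) := fun u Y =>
    K.ae_mem_boundedRuns T (u, Y) (hcon _ _ (hIcc u Y)).1 (hcon _ _ (hIcc u Y)).2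
  have hcoll : Cells.indexLaw T C (Cells.collision T C M) ≤ 1 / (24 : ℕ) := by
    refine (Cells.indexLaw_collision_le T M).trans ?_
    rw [← div_eq_mul_inv, Fintype.card_coe, ← Nat.cast_pow]
    exact natCast_div_le_of_mul_le (by norm_num) hCpos (samples_sq_le hr4 hd hCcard)
  have hne : ∀ k ≤ 2 * h, (Finset.univ.powersetCard k : Finset (Finset (Fin (d - d / 2)))).Nonempty :=
    fun k hk => Finset.powersetCard_nonempty.2 (by simp; omega)
  have hfind : ∀ k, 2 * h - 1 ≤ k → k ≤ 2 * h →
      ((Q * ballCard (d - d / 2) (h - 1) : ℕ) : ℝ≥0∞) /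
        (Finset.univ.powersetCard k : Finset (Finset (Fin (d - d / 2)))).card ≤ 1 / (24 : ℕ) := by
    intro k hk hk'
    refine natCast_div_le_of_mul_le (by norm_num) (Finset.card_ne_zero.2 (hne k hk')) ?_
    rw [Finset.card_powersetCard, Finset.card_univ, Fintype.card_fin]
    exact queries_mul_ballCard_le (by omega) hd hk hk'
  have hacc := K.le_lintegral_visibleRuns T M Q .accept (Finset.univ.powersetCard (2 * h))
    (hne _ le_rfl) (fun u Y _ => hbd u Y) fun u Y hY => by
      rw [K.indexLaw_hardRuns]
      exact (hT _ _ (hIcc u Y)).1 (K.isLip_hardFn u (Finset.mem_powersetCard.1 hY).2)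
  have hrej := K.le_lintegral_visibleRuns T M Q .reject (Finset.univ.powersetCard (2 * h - 1))
    (hne _ (Nat.sub_le _ _)) (fun u Y _ => hbd u Y) fun u Y hY => by
      have hYc : Y.card = 2 * h - 1 := (Finset.mem_powersetCard.1 hY).2
      rw [K.indexLaw_hardRuns]
      exact (hT _ _ (hIcc u Y)).2 (K.half_le_distToLip u (Y := Y) (by omega) (by omega))
  -- Superadditivity of the lower integral suffices, so measurability of the visible runs is never
  -- required.
  have hsum := (le_lintegral_add (μ := Cells.indexLaw T C)
    (fun p => ((K.visibleRuns T M .accept p).card : ℝ≥0∞) /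
      Fintype.card (C → Cube (d - d / 2)))
    (fun p => ((K.visibleRuns T M .reject p).card : ℝ≥0∞) /
      Fintype.card (C → Cube (d - d / 2)))).trans (lintegral_mono (g := fun _ => 1) fun p => by
      rw [← ENNReal.add_div, ← Nat.cast_add]
      exact ENNReal.div_le_of_le_mul (by
        rw [one_mul]
        exact Nat.cast_le.2 (K.card_visibleRuns_add_le T M p)))
  rw [lintegral_const, measure_univ, one_mul] at hsum
  -- Two errors of 1/24 for each verdict: 4/3 would be at most 7/6.
  have h43 : (2 / 3 : ℝ≥0∞) + 2 / 3 ≤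
      1 + (1 / (24 : ℕ) + 1 / (24 : ℕ)) + (1 / (24 : ℕ) + 1 / (24 : ℕ)) := by
    refine (add_le_add hacc hrej).trans ?_
    refine le_trans (le_of_eq ?_) (add_le_add (add_le_add hsum
      (add_le_add (hfind (2 * h) (Nat.sub_le _ _) le_rfl)
        (hfind (2 * h - 1) le_rfl (Nat.sub_le _ _)))) (add_le_add hcoll hcoll))
    ring
  have hlt : (1 : ℝ≥0∞) + (1 / (24 : ℕ) + 1 / (24 : ℕ)) + (1 / (24 : ℕ) + 1 / (24 : ℕ)) <
      2 / 3 + 2 / 3 := by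
    rw [← ENNReal.toReal_lt_toReal (by finiteness) (by finiteness)]
    rw [ENNReal.toReal_add, ENNReal.toReal_add, ENNReal.toReal_add, ENNReal.toReal_add]
    · norm_num
    all_goals finiteness
  exact absurd h43 (not_le.2 hlt)
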